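/- Let $X$ be a non-empty compact Hausdorff space (not necessarily separable) on which a countable discrete group $G$ acts by homeomorphisms, and let $(\pi,u)$ be a covariant representation of $(C(X),G)$ on a Hilbert space $H$: $\pi$ is a unital $*$-representation of $C(X)$ on $H$, $u$ is a unitary representation of $G$ on $H$, and $u_s\pi(f)u_s^*=\pi(f(s^{-1}\,\cdot\,))$ for all $s\in G$, $f\in C(X)$. Suppose that $(\pi,u)$ is cyclic, i.e. the associated representation $\pi\rtimes u$ of the crossed product $C(X)\rtimes G$ on $H$ has a cyclic vector. Then there is a Radon probability measure $\nu$ on $X$ that is $G$-quasi-invariant (for every $s\in G$, the push-forward $s\nu$ has the same null sets as $\nu$), together with a unital $*$-homomorphism $\Phi:L^\infty(X,\nu)\to\pi(C(X))''$ that is continuous for the $\sigma$-weak topologies (the topology $\sigma(L^\infty,L^1)$ on $L^\infty(X,\nu)$ and the ultraweak topology on the von Neumann algebra $\pi(C(X))''$) and $G$-equivariant: $\Phi(f(s^{-1}\,\cdot\,))=u_s\Phi(f)u_s^*$ for all $s\in G$ and $f\in L^\infty(X,\nu)$. -/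

import Mathlib

open MeasureTheory
open scoped ENNReal Topology

noncomputable section

/-! ### The von Neumann algebra `L^∞(X, ν)` -/

/-- `L^∞(X, ν)`: essentially bounded complex functions modulo equality `ν`-almost everywhere. -/
abbrev Linfty {X : Type*} [MeasurableSpace X] (ν : Measure X) : Type _ := Lp ℂ ∞ ν

namespace Linfty

variable {X : Type*} [MeasurableSpace X] {ν : Measure X}

instance instMul : Mul (Linfty ν) where
  mul f g := ⟨f.1 * g.1, by
    rw [Lp.mem_Lp_iff_eLpNorm_lt_top, eLpNorm_congr_ae (AEEqFun.coeFn_mul f.1 g.1)]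
    exact ((Lp.memLp g).mul (r := ∞) (Lp.memLp f)).2⟩

instance instOne : One (Linfty ν) where
  one := ⟨1, by
    rw [Lp.mem_Lp_iff_eLpNorm_lt_top, eLpNorm_congr_ae AEEqFun.coeFn_one]
    exact (memLp_top_const (1 : ℂ)).2⟩

/-- Multiplication in `L^∞(X, ν)` is the pointwise one. -/
instance instCommRing : CommRing (Linfty ν) where
  __ := (inferInstance : AddCommGroup (Linfty ν))
  left_distrib f g h := Subtype.ext <| by
    change f.1 * (g.1 + h.1) = f.1 * g.1 + f.1 * h.1
    refine AEEqFun.induction_on₃ f.1 g.1 h.1 fun a ha b hb c hc => ?_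
    simp only [AEEqFun.mk_add_mk, AEEqFun.mk_mul_mk, mul_add]
  right_distrib f g h := Subtype.ext <| by
    change (f.1 + g.1) * h.1 = f.1 * h.1 + g.1 * h.1
    refine AEEqFun.induction_on₃ f.1 g.1 h.1 fun a ha b hb c hc => ?_
    simp only [AEEqFun.mk_add_mk, AEEqFun.mk_mul_mk, add_mul]
  zero_mul f := Subtype.ext <| by
    change 0 * f.1 = 0
    refine AEEqFun.induction_on f.1 fun a ha => ?_
    simp only [AEEqFun.zero_def, AEEqFun.mk_mul_mk, Pi.mul_def, zero_mul]
  mul_zero f := Subtype.ext <| by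
    change f.1 * 0 = 0
    refine AEEqFun.induction_on f.1 fun a ha => ?_
    simp only [AEEqFun.zero_def, AEEqFun.mk_mul_mk, Pi.mul_def, mul_zero]
  mul_assoc f g h := Subtype.ext <| mul_assoc f.1 g.1 h.1
  one_mul f := Subtype.ext <| one_mul f.1
  mul_one f := Subtype.ext <| mul_one f.1
  mul_comm f g := Subtype.ext <| mul_comm f.1 g.1

instance instAlgebra : Algebra ℂ (Linfty ν) :=
  Algebra.ofModule
    (fun c f g => Subtype.ext <| by
      change (c • f.1) * g.1 = c • (f.1 * g.1)
      refine AEEqFun.induction_on₂ f.1 g.1 fun a ha b hb => ?_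
      simp only [AEEqFun.smul_mk, AEEqFun.mk_mul_mk, smul_mul_assoc])
    (fun c f g => Subtype.ext <| by
      change f.1 * (c • g.1) = c • (f.1 * g.1)
      refine AEEqFun.induction_on₂ f.1 g.1 fun a ha b hb => ?_
      simp only [AEEqFun.smul_mk, AEEqFun.mk_mul_mk, mul_smul_comm])

/-- The `σ`-weak topology of `L^∞(X, ν)`: the weakest topology for which `f ↦ ∫ f g dν` is
continuous for every `g ∈ L^1(X, ν)`. -/
abbrev sigmaWeakTopology (ν : Measure X) : TopologicalSpace (Linfty ν) :=
  ⨅ g : Lp ℂ 1 ν, TopologicalSpace.induced (fun f : Linfty ν => ∫ x, f x * g x ∂ν) inferInstance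

end Linfty

/-! ### Quasi-invariant measures -/

/-- `ν` is quasi-invariant: every `s ∈ G` maps `ν` to a measure with the same null sets. -/
def IsQuasiInvariant (G : Type*) {X : Type*} [SMul G X] [MeasurableSpace X]
    (ν : Measure X) : Prop :=
  ∀ s : G, ν.map (fun x => s • x) ≪ ν ∧ ν ≪ ν.map (fun x => s • x)

/-- The translate `s f = f(s⁻¹ ·)` of `f ∈ L^∞(X, ν)`, for a quasi-invariant `ν`. -/
def Linfty.translate {G X : Type*} [Group G] [MulAction G X] [MeasurableSpace X]
    [MeasurableConstSMul G X] {ν : Measure X} (hν : IsQuasiInvariant G ν) (s : G)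
    (f : Linfty ν) : Linfty ν :=
  have h : Measure.QuasiMeasurePreserving (fun x : X => s⁻¹ • x) ν ν :=
    ⟨measurable_const_smul s⁻¹, (hν s⁻¹).1⟩
  ⟨f.1.compQuasiMeasurePreserving (fun x => s⁻¹ • x) h, by
    rw [Lp.mem_Lp_iff_eLpNorm_lt_top,
      eLpNorm_congr_ae (AEEqFun.coeFn_compQuasiMeasurePreserving f.1 h), eLpNorm_exponent_top]
    refine lt_of_le_of_lt ?_ (eLpNorm_exponent_top (f := f) (μ := ν) ▸ Lp.eLpNorm_lt_top f)
    exact essSup_le_of_ae_le _ (h.ae (ae_le_eLpNormEssSup (f := f) (μ := ν)))⟩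

/-! ### Operators on a Hilbert space -/

section Hilbert

variable {H : Type*} [NormedAddCommGroup H] [InnerProductSpace ℂ H] [CompleteSpace H]

/-- The von Neumann algebra `S''` of a `*`-subalgebra `S` of the bounded operators on `H`. -/
def bicommutant (S : StarSubalgebra ℂ (H →L[ℂ] H)) : VonNeumannAlgebra H where
  toStarSubalgebra :=
    StarSubalgebra.centralizer ℂ (StarSubalgebra.centralizer ℂ (S : Set (H →L[ℂ] H)) :
      Set (H →L[ℂ] H))
  centralizer_centralizer' := by
    change Set.centralizer (Set.centralizer
      (StarSubalgebra.centralizer ℂ (StarSubalgebra.centralizer ℂ (S : Set (H →L[ℂ] H)) :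
        Set (H →L[ℂ] H)) : Set (H →L[ℂ] H))) =
      (StarSubalgebra.centralizer ℂ (StarSubalgebra.centralizer ℂ (S : Set (H →L[ℂ] H)) :
        Set (H →L[ℂ] H)) : Set (H →L[ℂ] H))
    rw [StarSubalgebra.coe_centralizer_centralizer, Set.centralizer_centralizer_centralizer]

/-- A von Neumann algebra is a complex algebra. -/
instance VonNeumannAlgebra.instSubalgebraAlgebra (M : VonNeumannAlgebra H) : Algebra ℂ M :=
  inferInstanceAs (Algebra ℂ M.toStarSubalgebra)

/-- The `σ`-weak (ultraweak) topology of a von Neumann algebra `M` on `H`: the weakest topology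
for which `T ↦ ∑ₙ ⟨T ξₙ, ηₙ⟩` is continuous for all square-summable sequences `ξ`, `η` in `H`
(the inner product of Mathlib is conjugate-linear in its first argument). -/
abbrev VonNeumannAlgebra.sigmaWeakTopology (M : VonNeumannAlgebra H) : TopologicalSpace M :=
  ⨅ p : lp (fun _ : ℕ => H) 2 × lp (fun _ : ℕ => H) 2,
    TopologicalSpace.induced
      (fun T : M => ∑' n, inner ℂ (p.2 n) ((T : H →L[ℂ] H) (p.1 n))) inferInstance

end Hilbert

/-! ### Covariant representations -/

/-- The translate `s f = f(s⁻¹ ·)` of a continuous function `f`. -/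
def translateC {G X : Type*} [Group G] [TopologicalSpace X] [MulAction G X]
    [ContinuousConstSMul G X] (s : G) (f : C(X, ℂ)) : C(X, ℂ) :=
  f.comp ⟨fun x => s⁻¹ • x, continuous_const_smul s⁻¹⟩

/-- A covariant representation `(π, u)` of `(C(X), G)` on the Hilbert space `H`: a unital
`*`-representation `π` of `C(X)` and a unitary representation `u` of `G` with
`u_s π(f) u_s^* = π(s f)`. -/
structure CovariantRep (G X H : Type*) [Group G] [TopologicalSpace X] [CompactSpace X]
    [MulAction G X] [ContinuousConstSMul G X]
    [NormedAddCommGroup H] [InnerProductSpace ℂ H] [CompleteSpace H] where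
  π : C(X, ℂ) →⋆ₐ[ℂ] (H →L[ℂ] H)
  u : G →* unitary (H →L[ℂ] H)
  covariant : ∀ (s : G) (f : C(X, ℂ)),
    (u s : H →L[ℂ] H) * π f * star (u s : H →L[ℂ] H) = π (translateC s f)

namespace CovariantRep

variable {G X H : Type*} [Group G] [TopologicalSpace X] [CompactSpace X]
  [MulAction G X] [ContinuousConstSMul G X]
  [NormedAddCommGroup H] [InnerProductSpace ℂ H] [CompleteSpace H]

/-- The integrated form `∑ₛ fₛ δₛ ↦ ∑ₛ π(fₛ) uₛ` on the dense `*`-subalgebra `C_c(G, C(X))` of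
the crossed product `C(X) ⋊ G`. -/
def integratedForm (R : CovariantRep G X H) (a : G →₀ C(X, ℂ)) : H →L[ℂ] H :=
  a.sum fun s f => R.π f * (R.u s : H →L[ℂ] H)

/-- The image `(π ⋊ u)(C(X) ⋊ G)` of the crossed product. The image of a `*`-homomorphism of
`C^*`-algebras is norm-closed, so it is the norm closure of the image of `C_c(G, C(X))`. -/
def crossedProductImage (R : CovariantRep G X H) : Set (H →L[ℂ] H) :=
  closure (Set.range R.integratedForm)

/-- `(π, u)` is cyclic if the representation `π ⋊ u` of the crossed product has a cyclic
vector. -/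
def IsCyclic (R : CovariantRep G X H) : Prop :=
  ∃ ξ : H, Dense ((fun T : H →L[ℂ] H => T ξ) '' R.crossedProductImage)

/-- The von Neumann algebra `π(C(X))''`. -/
def vonNeumann (R : CovariantRep G X H) : VonNeumannAlgebra H :=
  bicommutant R.π.range

end CovariantRep

end

/-!
The extension of `π` to bounded Borel functions is governed by the spectral measures `μ_v`, `v ∈ H`,
the regular measures on `X` with `∫ f dμ_v = ⟨v, π(f) v⟩` (Riesz–Markov–Kakutani). If a finite
regular measure `ν` dominates all of them, then `π` extends to `L^∞(X, ν)`: a bounded function is a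
bounded `ν`-almost everywhere limit of continuous functions `F n`, and the identity
`‖π(f) v‖² = ∫ |f|² dμ_v` together with dominated convergence shows that `π(F n)` converges strongly
to an operator `Φ(f)` that depends on `f` only. The quadratic form of `Φ(f)` is
`⟨v, Φ(f) v⟩ = ∫ f dμ_v` (`inner_strongExtension`). From it come linearity, compatibility with
adjoints, equivariance (since `μ_{u_s v}` is the translate of `μ_v`), and, after polarization,
`σ`-weak continuity: `f ↦ ∑ ⟨ζₙ, Φ(f) ζₙ⟩` is integration against the finite measure
`∑ μ_{ζₙ} ≪ ν`, hence against a density in `L¹(ν)` (`continuous_normalExtension`).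

For a cyclic vector `ξ`, the measure `ν` is an average, over the countable group `G` and with
positive weights, of the translates of the normalized `μ_ξ`. It is quasi-invariant, and it dominates
`μ_v` for `v = u_s ξ`. It then dominates every `μ_v`
(`CovariantRep.spectralMeasure_absolutelyContinuous_of_cyclic`): if `A` is `ν`-null and `F n → 1_A`
boundedly almost everywhere for `ν + μ_v`, then `π(F n)` tends to `0` on the vectors
`π(g) u_s ξ`, so, by density of their span, at `v`, while `⟨v, π(F n) v⟩ → μ_v(A)`.
-/

open Filter


noncomputable section

/-! ### Spectral measures -/

/-- A continuous function on a compact space is integrable for every finite Borel measure. -/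
lemma ContinuousMap.integrable_of_isFiniteMeasure {X : Type*} [TopologicalSpace X] [CompactSpace X]
    [MeasurableSpace X] [BorelSpace X] {μ : Measure X} [IsFiniteMeasure μ] (f : C(X, ℂ)) :
    Integrable f μ :=
  (BoundedContinuousFunction.mkOfCompact f).integrable μ

section SpectralMeasure

variable {X H : Type*} [TopologicalSpace X]
  [NormedAddCommGroup H] [InnerProductSpace ℂ H] [CompleteSpace H]

lemma inner_map_star_mul_self (π : C(X, ℂ) →⋆ₐ[ℂ] (H →L[ℂ] H)) (f : C(X, ℂ)) (v : H) :
    inner ℂ v (π (star f * f) v) = (‖π f v‖ ^ 2 : ℝ) := by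
  rw [map_mul, map_star, mul_apply_eq_comp, ContinuousLinearMap.star_eq_adjoint,
    ContinuousLinearMap.adjoint_inner_right, inner_self_eq_norm_sq_to_K]
  norm_cast

/-- A real continuous function, viewed as a complex one. -/
def ContinuousMap.toComplex (f : C(X, ℝ)) : C(X, ℂ) := ⟨fun x => (f x : ℂ), by fun_prop⟩

lemma inner_map_toComplex_nonneg (π : C(X, ℂ) →⋆ₐ[ℂ] (H →L[ℂ] H)) {f : C(X, ℝ)} (hf : 0 ≤ f)
    (v : H) : 0 ≤ (inner ℂ v (π f.toComplex v)).re := by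
  let g : C(X, ℝ) := ⟨fun x => √(f x), by fun_prop⟩
  have h : f.toComplex = star g.toComplex * g.toComplex := by
    ext x
    have : √(f x) * √(f x) = f x := Real.mul_self_sqrt (hf x)
    simp [ContinuousMap.toComplex, g, ← Complex.ofReal_mul, this]
  rw [h, inner_map_star_mul_self, Complex.ofReal_re]
  positivity

lemma inner_map_toComplex_im (π : C(X, ℂ) →⋆ₐ[ℂ] (H →L[ℂ] H)) (f : C(X, ℝ)) (v : H) :
    (inner ℂ v (π f.toComplex v)).im = 0 := by
  have h : star f.toComplex = f.toComplex := by
    ext x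
    simp [ContinuousMap.toComplex]
  rw [← Complex.conj_eq_iff_im, inner_conj_symm]
  conv_lhs => rw [← ContinuousLinearMap.adjoint_inner_right, ← ContinuousLinearMap.star_eq_adjoint,
    ← map_star, h]

variable [CompactSpace X]

/-- The positive functional `f ↦ ⟨v, π(f) v⟩` on the real continuous functions. -/
def vectorFunctional (π : C(X, ℂ) →⋆ₐ[ℂ] (H →L[ℂ] H)) (v : H) :
    CompactlySupportedContinuousMap X ℝ →ₚ[ℝ] ℝ where
  toFun f := (inner ℂ v (π (f : C(X, ℝ)).toComplex v)).re
  map_add' f g := by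
    have : ((f + g : CompactlySupportedContinuousMap X ℝ) : C(X, ℝ)).toComplex =
        (f : C(X, ℝ)).toComplex + (g : C(X, ℝ)).toComplex := by
      ext x
      simp [ContinuousMap.toComplex]
    rw [this, map_add, add_apply, inner_add_right, Complex.add_re]
  map_smul' c f := by
    have : ((c • f : CompactlySupportedContinuousMap X ℝ) : C(X, ℝ)).toComplex =
        (c : ℂ) • (f : C(X, ℝ)).toComplex := by
      ext x
      simp [ContinuousMap.toComplex]
    rw [this, map_smul, smul_apply, inner_smul_right, Complex.re_ofReal_mul]
    rfl
  monotone' f g hfg := by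
    have h : (g : C(X, ℝ)).toComplex =
        (f : C(X, ℝ)).toComplex + ((g : C(X, ℝ)) - (f : C(X, ℝ))).toComplex := by
      ext x
      simp [ContinuousMap.toComplex]
    have h0 : (0 : C(X, ℝ)) ≤ (g : C(X, ℝ)) - (f : C(X, ℝ)) := fun x => sub_nonneg.2 (hfg x)
    change (inner ℂ v (π (f : C(X, ℝ)).toComplex v)).re ≤
      (inner ℂ v (π (g : C(X, ℝ)).toComplex v)).re
    rw [h, map_add, add_apply, inner_add_right, Complex.add_re]
    exact le_add_of_nonneg_right (inner_map_toComplex_nonneg π h0 v)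

variable [T2Space X] [MeasurableSpace X] [BorelSpace X]

/-- The spectral measure of the vector `v` for a representation `π` of `C(X)`: the regular Borel
measure representing the positive functional `f ↦ ⟨v, π(f) v⟩`. -/
def spectralMeasure (π : C(X, ℂ) →⋆ₐ[ℂ] (H →L[ℂ] H)) (v : H) : Measure X :=
  RealRMK.rieszMeasure (vectorFunctional π v)

instance spectralMeasure.instIsFiniteMeasure (π : C(X, ℂ) →⋆ₐ[ℂ] (H →L[ℂ] H)) (v : H) :
    IsFiniteMeasure (spectralMeasure π v) := by
  unfold spectralMeasure; infer_instance

instance spectralMeasure.instRegular (π : C(X, ℂ) →⋆ₐ[ℂ] (H →L[ℂ] H)) (v : H) :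
    (spectralMeasure π v).Regular := by
  unfold spectralMeasure; infer_instance

lemma integral_spectralMeasure_toComplex (π : C(X, ℂ) →⋆ₐ[ℂ] (H →L[ℂ] H)) (v : H) (f : C(X, ℝ)) :
    ((∫ x, f x ∂spectralMeasure π v : ℝ) : ℂ) = inner ℂ v (π f.toComplex v) := by
  let f' : CompactlySupportedContinuousMap X ℝ := ⟨f, HasCompactSupport.of_compactSpace _⟩
  have h := RealRMK.integral_rieszMeasure (vectorFunctional π v) f'
  change ∫ x, f x ∂spectralMeasure π v = (inner ℂ v (π f.toComplex v)).re at h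
  rw [h]
  apply Complex.ext
  · simp
  · simp [inner_map_toComplex_im]

lemma integral_spectralMeasure (π : C(X, ℂ) →⋆ₐ[ℂ] (H →L[ℂ] H)) (v : H) (f : C(X, ℂ)) :
    ∫ x, f x ∂spectralMeasure π v = inner ℂ v (π f v) := by
  let fr : C(X, ℝ) := ⟨fun x => (f x).re, by fun_prop⟩
  let fi : C(X, ℝ) := ⟨fun x => (f x).im, by fun_prop⟩
  have h : f = fr.toComplex + Complex.I • fi.toComplex := by
    ext x
    simp only [ContinuousMap.add_apply, ContinuousMap.smul_apply, smul_eq_mul]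
    rw [mul_comm]
    exact (Complex.re_add_im (f x)).symm
  have h1 : π f v = π fr.toComplex v + Complex.I • π fi.toComplex v := by
    conv_lhs => rw [h, map_add, map_smul]
    rfl
  rw [h1, inner_add_right, inner_smul_right, ← integral_spectralMeasure_toComplex,
    ← integral_spectralMeasure_toComplex, mul_comm]
  exact (integral_re_add_im (𝕜 := ℂ) f.integrable_of_isFiniteMeasure).symm

lemma integral_norm_sq_spectralMeasure (π : C(X, ℂ) →⋆ₐ[ℂ] (H →L[ℂ] H)) (v : H) (f : C(X, ℂ)) :
    ∫ x, ‖f x‖ ^ 2 ∂spectralMeasure π v = ‖π f v‖ ^ 2 := by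
  have h := integral_spectralMeasure π v (star f * f)
  rw [inner_map_star_mul_self] at h
  rw [← Complex.ofReal_inj, ← h, ← integral_complex_ofReal]
  congr 1 with x
  simp [Complex.conj_mul']

lemma spectralMeasure_univ (π : C(X, ℂ) →⋆ₐ[ℂ] (H →L[ℂ] H)) (v : H) :
    spectralMeasure π v Set.univ = ENNReal.ofReal (‖v‖ ^ 2) := by
  have h := integral_norm_sq_spectralMeasure π v 1
  simp only [ContinuousMap.one_apply, norm_one, one_pow, integral_const, smul_eq_mul, mul_one,
    map_one, one_apply_eq_self] at h
  rw [← h, ofReal_measureReal]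

/-- A regular finite measure is the spectral measure of `v` as soon as it represents the
functional `f ↦ ⟨v, π(f) v⟩`. -/
lemma eq_spectralMeasure (π : C(X, ℂ) →⋆ₐ[ℂ] (H →L[ℂ] H)) (v : H) {μ : Measure X}
    [IsFiniteMeasure μ] [μ.Regular] (h : ∀ f : C(X, ℂ), ∫ x, f x ∂μ = inner ℂ v (π f v)) :
    μ = spectralMeasure π v := by
  refine Measure.ext_of_integral_eq_on_compactlySupported fun f => ?_
  rw [← Complex.ofReal_inj, ← integral_complex_ofReal, ← integral_complex_ofReal]
  exact (h (f : C(X, ℝ)).toComplex).trans (integral_spectralMeasure π v _).symm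

/-- Covariance for spectral measures: the spectral measure of `u_s v` is the translate by `s` of
that of `v`. -/
lemma CovariantRep.spectralMeasure_u {G : Type*} [Group G] [MulAction G X]
    [ContinuousConstSMul G X] (R : CovariantRep G X H) (s : G) (v : H) :
    spectralMeasure R.π ((R.u s : H →L[ℂ] H) v) =
      (spectralMeasure R.π v).map (fun x => s • x) := by
  have : ((spectralMeasure R.π v).map (fun x => s • x)).Regular :=
    Measure.Regular.map (Homeomorph.smul s)
  have : IsFiniteMeasure ((spectralMeasure R.π v).map (fun x => s • x)) :=
    Measure.isFiniteMeasure_map _ _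
  refine (eq_spectralMeasure _ _ fun f => ?_).symm
  rw [integral_map (measurable_const_smul s).aemeasurable
    (f.continuous.measurable.aestronglyMeasurable)]
  have h1 : translateC s (f.comp ⟨fun x => s • x, continuous_const_smul s⟩) = f := by
    ext x
    simp [translateC]
  have h2 := R.covariant s (f.comp ⟨fun x => s • x, continuous_const_smul s⟩)
  rw [h1] at h2
  have h3 : star (R.u s : H →L[ℂ] H) * (R.u s : H →L[ℂ] H) = 1 := Unitary.coe_star_mul_self _
  have h4 (w : H) : star (R.u s : H →L[ℂ] H) ((R.u s : H →L[ℂ] H) w) = w :=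
    DFunLike.congr_fun h3 w
  rw [← h2, mul_apply_eq_comp, mul_apply_eq_comp, h4,
    ← ContinuousLinearMap.adjoint_inner_left, ← ContinuousLinearMap.star_eq_adjoint, h4,
    ← integral_spectralMeasure]
  rfl

end SpectralMeasure

/-! ### Bounded almost everywhere convergence of continuous functions -/

section BoundedConvergence

variable {X : Type*} [TopologicalSpace X] [CompactSpace X] [MeasurableSpace X]

/-- `F i → f` boundedly `ν`-almost everywhere along `l`: the continuous functions `F i` are
uniformly bounded and converge to `f` pointwise off a `ν`-null set. -/
structure BoundedlyConverges {ι : Type*} (ν : Measure X) (l : Filter ι) (F : ι → C(X, ℂ))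
    (f : X → ℂ) : Prop where
  bound : ∃ M : ℝ, ∀ i, ‖F i‖ ≤ M
  tendsto : ∀ᵐ x ∂ν, Tendsto (fun i => F i x) l (𝓝 (f x))

namespace BoundedlyConverges

variable {ι : Type*} {μ ν : Measure X} {l : Filter ι} {F K : ι → C(X, ℂ)} {f k : X → ℂ}

lemma mono (h : BoundedlyConverges ν l F f) (hμ : μ ≪ ν) : BoundedlyConverges μ l F f :=
  ⟨h.bound, hμ.ae_le h.tendsto⟩

lemma congr (h : BoundedlyConverges ν l F f) (hk : f =ᵐ[ν] k) : BoundedlyConverges ν l F k := by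
  refine ⟨h.bound, ?_⟩
  filter_upwards [h.tendsto, hk] with x hx hxk
  rwa [← hxk]

lemma sub (h : BoundedlyConverges ν l F f) (h' : BoundedlyConverges ν l K k) :
    BoundedlyConverges ν l (F - K) (f - k) := by
  obtain ⟨M, hM⟩ := h.bound
  obtain ⟨M', hM'⟩ := h'.bound
  refine ⟨⟨M + M', fun i => (norm_sub_le _ _).trans (add_le_add (hM i) (hM' i))⟩, ?_⟩
  filter_upwards [h.tendsto, h'.tendsto] with x hx hx'
  exact hx.sub hx'

lemma mul (h : BoundedlyConverges ν l F f) (h' : BoundedlyConverges ν l K k) :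
    BoundedlyConverges ν l (F * K) (f * k) := by
  obtain ⟨M, hM⟩ := h.bound
  obtain ⟨M', hM'⟩ := h'.bound
  refine ⟨⟨M * M', fun i => (norm_mul_le _ _).trans ?_⟩, ?_⟩
  · exact mul_le_mul (hM i) (hM' i) (norm_nonneg _) ((norm_nonneg _).trans (hM i))
  filter_upwards [h.tendsto, h'.tendsto] with x hx hx'
  exact hx.mul hx'

lemma comp {κ : Type*} {l' : Filter κ} {φ : κ → ι} (h : BoundedlyConverges ν l F f)
    (hφ : Tendsto φ l' l) : BoundedlyConverges ν l' (F ∘ φ) f :=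
  ⟨h.bound.imp fun _ hM i => hM (φ i), h.tendsto.mono fun _ hx => hx.comp hφ⟩

variable [BorelSpace X]

lemma tendsto_integral [l.IsCountablyGenerated] [IsFiniteMeasure ν]
    (h : BoundedlyConverges ν l F f) :
    Tendsto (fun i => ∫ x, F i x ∂ν) l (𝓝 (∫ x, f x ∂ν)) := by
  obtain ⟨M, hM⟩ := h.bound
  refine tendsto_integral_filter_of_dominated_convergence (fun _ => M) ?_ ?_
    (integrable_const M) h.tendsto
  · exact Eventually.of_forall fun i => (F i).integrable_of_isFiniteMeasure.aestronglyMeasurable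
  · exact Eventually.of_forall fun i => Eventually.of_forall fun x =>
      ((F i).norm_coe_le_norm x).trans (hM i)

variable [T2Space X] {H : Type*} [NormedAddCommGroup H] [InnerProductSpace ℂ H] [CompleteSpace H]

/-- If `F i → 0` boundedly almost everywhere for the spectral measure of `v`, then
`‖π(F i) v‖² = ∫ |F i|²` tends to `0` by dominated convergence. -/
lemma tendsto_apply_zero [l.IsCountablyGenerated] {π : C(X, ℂ) →⋆ₐ[ℂ] (H →L[ℂ] H)} {v : H}
    (h : BoundedlyConverges (spectralMeasure π v) l F 0) :
    Tendsto (fun i => π (F i) v) l (𝓝 0) := by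
  obtain ⟨M, hM⟩ := h.bound
  have h1 : Tendsto (fun i => ∫ x, ‖F i x‖ ^ 2 ∂spectralMeasure π v) l
      (𝓝 (∫ _, (0 : ℝ) ∂spectralMeasure π v)) := by
    refine tendsto_integral_filter_of_dominated_convergence (fun _ => M ^ 2) ?_ ?_
      (integrable_const _) ?_
    · exact Eventually.of_forall fun i =>
        ((F i).integrable_of_isFiniteMeasure.aestronglyMeasurable).norm.pow 2
    · refine Eventually.of_forall fun i => Eventually.of_forall fun x => ?_
      rw [norm_pow, norm_norm]
      exact pow_le_pow_left₀ (norm_nonneg _) (((F i).norm_coe_le_norm x).trans (hM i)) 2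
    · filter_upwards [h.tendsto] with x hx
      simpa using hx.norm.pow 2
  simp only [integral_norm_sq_spectralMeasure, integral_zero] at h1
  rw [tendsto_zero_iff_norm_tendsto_zero]
  simpa using h1.sqrt

end BoundedlyConverges

/-- The radial retraction of `ℂ` onto the closed disc of radius `M > 0`. -/
def radialTruncation (M : ℝ) (z : ℂ) : ℂ := ((M / max M ‖z‖ : ℝ) : ℂ) * z

lemma continuous_radialTruncation {M : ℝ} (hM : 0 < M) : Continuous (radialTruncation M) := by
  unfold radialTruncation
  have h (z : ℂ) : max M ‖z‖ ≠ 0 := (hM.trans_le (le_max_left _ _)).ne'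
  fun_prop (disch := exact h _)

lemma norm_radialTruncation_le {M : ℝ} (hM : 0 < M) (z : ℂ) : ‖radialTruncation M z‖ ≤ M := by
  have h : 0 < max M ‖z‖ := hM.trans_le (le_max_left _ _)
  rw [radialTruncation, norm_mul, Complex.norm_real, Real.norm_of_nonneg (by positivity),
    div_mul_eq_mul_div, div_le_iff₀ h]
  exact mul_le_mul_of_nonneg_left (le_max_right _ _) hM.le

lemma radialTruncation_of_norm_le {M : ℝ} (hM : 0 < M) {z : ℂ} (hz : ‖z‖ ≤ M) :
    radialTruncation M z = z := by
  rw [radialTruncation, max_eq_left hz, div_self hM.ne', Complex.ofReal_one, one_mul]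

/-- Every essentially bounded function is a bounded almost everywhere limit of a sequence of
continuous functions: approximate it in `L¹`, pass to a subsequence, and truncate. -/
lemma exists_boundedlyConverges [T2Space X] [BorelSpace X] {ν : Measure X} [IsFiniteMeasure ν]
    [ν.Regular] {f : X → ℂ} (hf : MemLp f ∞ ν) :
    ∃ F : ℕ → C(X, ℂ), BoundedlyConverges ν atTop F f := by
  have hf1 : MemLp f 1 ν := hf.mono_exponent le_top
  have hex (n : ℕ) := hf1.exists_boundedContinuous_eLpNorm_sub_le ENNReal.one_ne_top
    (ε := ((n : ℝ≥0∞) + 1)⁻¹) (ENNReal.inv_ne_zero.2 (by finiteness))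
  choose g hg hgm using hex
  have hlim : Tendsto (fun n => eLpNorm (⇑(g n) - f) 1 ν) atTop (𝓝 0) := by
    refine tendsto_of_tendsto_of_tendsto_of_le_of_le tendsto_const_nhds
      ((tendsto_add_atTop_iff_nat 1).2 ENNReal.tendsto_inv_nat_nhds_zero) (fun _ => zero_le)
      fun n => ?_
    rw [eLpNorm_sub_comm]
    simpa using hg n
  obtain ⟨φ, -, hφ⟩ := (tendstoInMeasure_of_tendsto_eLpNorm one_ne_zero
    (fun n => (hgm n).1) hf1.1 hlim).exists_seq_tendsto_ae
  obtain ⟨M, hM, hfM⟩ : ∃ M : ℝ, 0 < M ∧ ∀ᵐ x ∂ν, ‖f x‖ ≤ M := by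
    refine ⟨(eLpNormEssSup f ν).toReal + 1, by positivity, ?_⟩
    have hlt : eLpNormEssSup f ν ≠ ∞ := by
      rw [← eLpNorm_exponent_top]; exact hf.2.ne
    filter_upwards [ae_le_eLpNormEssSup (f := f) (μ := ν)] with x hx
    have := ENNReal.toReal_mono hlt hx
    rw [toReal_enorm] at this
    linarith
  refine ⟨fun n => ⟨fun x => radialTruncation M (g (φ n) x),
    (continuous_radialTruncation hM).comp (g (φ n)).continuous⟩, ⟨M, fun n => ?_⟩, ?_⟩
  · exact (ContinuousMap.norm_le _ hM.le).2 fun x => norm_radialTruncation_le hM _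
  · filter_upwards [hφ, hfM] with x hx hxM
    have := ((continuous_radialTruncation hM).tendsto (f x)).comp hx
    rwa [radialTruncation_of_norm_le hM hxM] at this

end BoundedConvergence

/-! ### Strong convergence and domination of spectral measures -/

section Normal

variable {X H : Type*} [TopologicalSpace X] [CompactSpace X]
  [NormedAddCommGroup H] [InnerProductSpace ℂ H] [CompleteSpace H]

lemma norm_map_apply_le (π : C(X, ℂ) →⋆ₐ[ℂ] (H →L[ℂ] H)) {f : C(X, ℂ)} {M : ℝ} (hf : ‖f‖ ≤ M)
    (v : H) : ‖π f v‖ ≤ M * ‖v‖ :=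
  ((π f).le_opNorm v).trans (mul_le_mul_of_nonneg_right
    ((NonUnitalStarAlgHom.norm_apply_le π f).trans hf) (norm_nonneg v))

/-- For uniformly bounded `F i`, the vectors `v` with `π(F i) v → 0` form a closed subspace. -/
lemma tendsto_apply_zero_of_dense {ι : Type*} {l : Filter ι}
    (π : C(X, ℂ) →⋆ₐ[ℂ] (H →L[ℂ] H)) {F : ι → C(X, ℂ)} {M : ℝ} (hM : ∀ i, ‖F i‖ ≤ M)
    {S : Set H} (hS : Dense S) (h : ∀ w ∈ S, Tendsto (fun i => π (F i) w) l (𝓝 0)) (v : H) :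
    Tendsto (fun i => π (F i) v) l (𝓝 0) := by
  rw [Metric.tendsto_nhds]
  intro ε hε
  obtain ⟨w, hwS, hw⟩ := hS.exists_dist_lt v (ε := ε / 2 / (|M| + 1)) (by positivity)
  filter_upwards [Metric.tendsto_nhds.1 (h w hwS) (ε / 2) (by positivity)] with i hi
  rw [dist_zero_right] at hi ⊢
  have h1 : π (F i) v = π (F i) (v - w) + π (F i) w := by rw [← map_add, sub_add_cancel]
  have h2 : ‖π (F i) (v - w)‖ ≤ (|M| + 1) * ‖v - w‖ :=
    norm_map_apply_le π ((hM i).trans ((le_abs_self M).trans (by linarith))) _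
  have h3 : (|M| + 1) * ‖v - w‖ < ε / 2 := by
    rw [dist_eq_norm, lt_div_iff₀ (by positivity)] at hw
    linarith
  rw [h1]
  linarith [norm_add_le (π (F i) (v - w)) (π (F i) w)]

variable [T2Space X] [MeasurableSpace X] [BorelSpace X]

/-- If bounded `ν`-almost everywhere convergence of continuous functions to `0` implies strong
convergence of their images at `v`, then the spectral measure of `v` is dominated by `ν`. -/
lemma spectralMeasure_absolutelyContinuous (π : C(X, ℂ) →⋆ₐ[ℂ] (H →L[ℂ] H)) {ν : Measure X}
    [IsFiniteMeasure ν] [ν.InnerRegular] {v : H}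
    (h : ∀ F : ℕ → C(X, ℂ), BoundedlyConverges ν atTop F 0 →
      Tendsto (fun n => π (F n) v) atTop (𝓝 0)) :
    spectralMeasure π v ≪ ν := by
  refine Measure.AbsolutelyContinuous.mk fun A hA hνA => ?_
  obtain ⟨F, hF⟩ := exists_boundedlyConverges (ν := ν + spectralMeasure π v)
    (f := A.indicator fun _ => (1 : ℂ)) ((memLp_top_const 1).indicator hA)
  have hν : BoundedlyConverges ν atTop F 0 :=
    (hF.mono (Measure.AbsolutelyContinuous.rfl.add_right _)).congr
      (indicator_meas_zero hνA)
  have hμ : BoundedlyConverges (spectralMeasure π v) atTop F _ :=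
    hF.mono (Measure.absolutelyContinuous_of_le (Measure.le_add_left le_rfl))
  have h1 := hμ.tendsto_integral
  simp only [integral_spectralMeasure] at h1
  have h2 := tendsto_nhds_unique h1
    (tendsto_const_nhds.inner (𝕜 := ℂ) (h F hν))
  rw [integral_indicator_const _ hA, inner_zero_right] at h2
  simpa [measureReal_eq_zero_iff] using h2

end Normal

/-! ### The normal extension -/

section Linfty

variable {X : Type*} [MeasurableSpace X] {μ ν : Measure X} [IsFiniteMeasure μ]

lemma Linfty.integrable_of_absolutelyContinuous (hμ : μ ≪ ν) (f : Linfty ν) : Integrable f μ := by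
  have hlt : eLpNormEssSup f ν ≠ ∞ := by
    rw [← eLpNorm_exponent_top]; exact (Lp.memLp f).2.ne
  refine Integrable.of_bound ((Lp.aestronglyMeasurable f).mono_ac hμ) (eLpNormEssSup f ν).toReal
    (hμ.ae_le ?_)
  filter_upwards [ae_le_eLpNormEssSup (f := f) (μ := ν)] with x hx
  rw [← toReal_enorm]
  exact ENNReal.toReal_mono hlt hx

/-- Integration against a finite measure `μ ≪ ν` is `σ`-weakly continuous, since
`∫ f dμ = ∫ f (dμ/dν) dν` with `dμ/dν ∈ L¹(ν)`. -/
lemma Linfty.continuous_integral [SigmaFinite ν] (hμ : μ ≪ ν) :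
    Continuous[Linfty.sigmaWeakTopology ν, inferInstance]
      (fun f : Linfty ν => ∫ x, f x ∂μ) := by
  have hint : Integrable (fun x => ((μ.rnDeriv ν x).toReal : ℂ)) ν :=
    Measure.integrable_toReal_rnDeriv.ofReal
  have h := (memLp_one_iff_integrable.2 hint)
  have heq (f : Linfty ν) : ∫ x, f x ∂μ = ∫ x, f x * h.toLp _ x ∂ν := by
    rw [← integral_rnDeriv_smul hμ]
    refine integral_congr_ae ?_
    filter_upwards [h.coeFn_toLp] with x hx
    rw [hx, mul_comm, Complex.real_smul]
  simp only [heq]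
  exact continuous_iInf_dom (i := h.toLp _) continuous_induced_dom

end Linfty

/-- An operator on a complex Hilbert space is determined by its quadratic form. -/
lemma ContinuousLinearMap.ext_inner_self {H : Type*} [NormedAddCommGroup H]
    [InnerProductSpace ℂ H] {S T : H →L[ℂ] H}
    (h : ∀ v, inner ℂ v (S v) = inner ℂ v (T v)) : S = T := by
  refine ContinuousLinearMap.coe_injective ((ext_inner_map _ _).1 fun v => ?_)
  have := congrArg (starRingEnd ℂ) (h v)
  rwa [inner_conj_symm, inner_conj_symm] at this

/-- Polarization, in the form in which each term on the right is a value of the quadratic form of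
`T`. -/
lemma ContinuousLinearMap.inner_polarization {H : Type*} [NormedAddCommGroup H]
    [InnerProductSpace ℂ H] (T : H →L[ℂ] H) (x y : H) :
    inner ℂ y (T x) = (inner ℂ (y + x) (T (y + x)) - inner ℂ (y - x) (T (y - x)) -
      Complex.I * inner ℂ (y + Complex.I • x) (T (y + Complex.I • x)) +
      Complex.I * inner ℂ (y - Complex.I • x) (T (y - Complex.I • x))) / 4 := by
  simp only [map_add, map_sub, map_smul, inner_add_left, inner_add_right, inner_sub_left,
    inner_sub_right, inner_smul_left, inner_smul_right, Complex.conj_I]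
  linear_combination (inner ℂ y (T x) - inner ℂ x (T y)) / 2 * Complex.I_sq

section NormalExtension

variable {X H : Type*} [TopologicalSpace X] [CompactSpace X] [T2Space X]
  [MeasurableSpace X] [BorelSpace X]
  [NormedAddCommGroup H] [InnerProductSpace ℂ H] [CompleteSpace H]
  {π : C(X, ℂ) →⋆ₐ[ℂ] (H →L[ℂ] H)} {ν : Measure X}

lemma BoundedlyConverges.cauchySeq_apply (hν : ∀ v, spectralMeasure π v ≪ ν)
    {F : ℕ → C(X, ℂ)} {f : X → ℂ} (hF : BoundedlyConverges ν atTop F f) (v : H) :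
    CauchySeq fun n => π (F n) v := by
  rw [cauchySeq_iff_tendsto_dist_atTop_0, ← prod_atTop_atTop_eq]
  have h := (((hF.comp (l' := atTop ×ˢ atTop) tendsto_fst).sub (hF.comp tendsto_snd)).congr
    (k := 0) (by simp)).mono (hν v)
  refine h.tendsto_apply_zero.norm.congr' ?_ |>.trans (by simp)
  exact Eventually.of_forall fun p => by simp [dist_eq_norm]

variable [IsFiniteMeasure ν] [ν.InnerRegular]

/-- Strong limits of the operators `π(F n)` exist, and do not depend on the approximating
sequence. -/
lemma exists_strong_limit (hν : ∀ v, spectralMeasure π v ≪ ν) (f : Linfty ν) :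
    ∃ T : H →L[ℂ] H, ∀ F : ℕ → C(X, ℂ), BoundedlyConverges ν atTop F f →
      ∀ v, Tendsto (fun n => π (F n) v) atTop (𝓝 (T v)) := by
  obtain ⟨F, hF⟩ := exists_boundedlyConverges (Lp.memLp f)
  choose T hT using fun v => cauchySeq_tendsto_of_complete (hF.cauchySeq_apply hν v)
  refine ⟨continuousLinearMapOfTendsto (fun n => π (F n)) (tendsto_pi_nhds.2 hT),
    fun K hK v => ?_⟩
  have h := ((hK.sub hF).congr (k := 0) (by simp)).mono (hν v)
  have h' := h.tendsto_apply_zero.add (hT v)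
  simp only [Pi.sub_apply, map_sub, sub_apply, sub_add_cancel, zero_add] at h'
  exact h'

/-- The operator `Φ(f)` extending `π` to `f ∈ L^∞(X, ν)`: the strong limit of `π(F n)` for any sequence `F n` of
continuous functions converging to `f` boundedly almost everywhere. -/
def strongExtension (hν : ∀ v, spectralMeasure π v ≪ ν) (f : Linfty ν) : H →L[ℂ] H :=
  (exists_strong_limit hν f).choose

lemma BoundedlyConverges.tendsto_strongExtension (hν : ∀ v, spectralMeasure π v ≪ ν)
    {F : ℕ → C(X, ℂ)} {f : Linfty ν} (hF : BoundedlyConverges ν atTop F f) (v : H) :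
    Tendsto (fun n => π (F n) v) atTop (𝓝 (strongExtension hν f v)) :=
  (exists_strong_limit hν f).choose_spec F hF v

/-- The quadratic form of `Φ(f)` is integration of `f` against spectral measures; this determines
`Φ(f)`. -/
lemma inner_strongExtension (hν : ∀ v, spectralMeasure π v ≪ ν) (f : Linfty ν) (v : H) :
    inner ℂ v (strongExtension hν f v) = ∫ x, f x ∂spectralMeasure π v := by
  obtain ⟨F, hF⟩ := exists_boundedlyConverges (Lp.memLp f)
  have h := (hF.mono (hν v)).tendsto_integral
  simp only [integral_spectralMeasure] at h
  exact tendsto_nhds_unique (tendsto_const_nhds.inner (hF.tendsto_strongExtension hν v)) h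

lemma strongExtension_one (hν : ∀ v, spectralMeasure π v ≪ ν) :
    strongExtension hν 1 = 1 := by
  ext v
  have h : BoundedlyConverges ν atTop (fun _ : ℕ => (1 : C(X, ℂ))) (1 : Linfty ν) :=
    BoundedlyConverges.congr ⟨⟨‖(1 : C(X, ℂ))‖, fun _ => le_rfl⟩,
      Eventually.of_forall fun _ => tendsto_const_nhds⟩ AEEqFun.coeFn_one.symm
  refine tendsto_nhds_unique (h.tendsto_strongExtension hν v) ?_
  simp

lemma strongExtension_mul (hν : ∀ v, spectralMeasure π v ≪ ν) (f g : Linfty ν) :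
    strongExtension hν (f * g) = strongExtension hν f * strongExtension hν g := by
  ext v
  obtain ⟨F, hF⟩ := exists_boundedlyConverges (Lp.memLp f)
  obtain ⟨K, hK⟩ := exists_boundedlyConverges (Lp.memLp g)
  have h := ((hF.mul hK).congr (AEEqFun.coeFn_mul f.1 g.1).symm)
  refine tendsto_nhds_unique (BoundedlyConverges.tendsto_strongExtension hν (f := f * g) h v) ?_
  obtain ⟨M, hM⟩ := hF.bound
  have h1 : Tendsto (fun n => M * ‖π (K n) v - strongExtension hν g v‖) atTop (𝓝 0) := by
    simpa using ((hK.tendsto_strongExtension hν v).sub_const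
      (strongExtension hν g v)).norm.const_mul M
  have h2 := (squeeze_zero_norm (fun n => norm_map_apply_le π (hM n) _) h1).add
    (hF.tendsto_strongExtension hν (strongExtension hν g v))
  simpa using h2

lemma strongExtension_add (hν : ∀ v, spectralMeasure π v ≪ ν) (f g : Linfty ν) :
    strongExtension hν (f + g) = strongExtension hν f + strongExtension hν g := by
  refine ContinuousLinearMap.ext_inner_self fun v => ?_
  rw [add_apply, inner_add_right, inner_strongExtension, inner_strongExtension,
    inner_strongExtension, ← integral_add (f.integrable_of_absolutelyContinuous (hν v))
      (g.integrable_of_absolutelyContinuous (hν v))]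
  exact integral_congr_ae ((hν v).ae_le (Lp.coeFn_add f g))

lemma strongExtension_smul (hν : ∀ v, spectralMeasure π v ≪ ν) (c : ℂ) (f : Linfty ν) :
    strongExtension hν (c • f) = c • strongExtension hν f := by
  refine ContinuousLinearMap.ext_inner_self fun v => ?_
  rw [smul_apply, inner_smul_right, inner_strongExtension, inner_strongExtension,
    ← integral_const_mul]
  exact integral_congr_ae ((hν v).ae_le (Lp.coeFn_smul c f))

lemma strongExtension_star (hν : ∀ v, spectralMeasure π v ≪ ν) (f : Linfty ν) :
    strongExtension hν (star f) = star (strongExtension hν f) := by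
  refine ContinuousLinearMap.ext_inner_self fun v => ?_
  rw [ContinuousLinearMap.star_eq_adjoint, ContinuousLinearMap.adjoint_inner_right,
    inner_strongExtension, ← inner_conj_symm, inner_strongExtension, ← integral_conj]
  exact integral_congr_ae ((hν v).ae_le (Lp.coeFn_star f))

lemma strongExtension_mem_bicommutant (hν : ∀ v, spectralMeasure π v ≪ ν) (f : Linfty ν) :
    strongExtension hν f ∈ bicommutant π.range := by
  change strongExtension hν f ∈ (StarSubalgebra.centralizer ℂ (StarSubalgebra.centralizer ℂ
    (π.range : Set (H →L[ℂ] H)) : Set (H →L[ℂ] H)) : Set (H →L[ℂ] H))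
  obtain ⟨F, hF⟩ := exists_boundedlyConverges (Lp.memLp f)
  -- An operator commuting with every `π(F n)` commutes with their strong limit.
  have key (T : H →L[ℂ] H) (hT : ∀ n, π (F n) * T = T * π (F n)) :
      T * strongExtension hν f = strongExtension hν f * T := by
    ext v
    refine tendsto_nhds_unique ((T.continuous.tendsto _).comp (hF.tendsto_strongExtension hν v))
      ((hF.tendsto_strongExtension hν (T v)).congr fun n => ?_)
    exact DFunLike.congr_fun (hT n) v
  rw [StarSubalgebra.coe_centralizer_centralizer, Set.mem_centralizer_iff]
  intro T hT
  exact key T fun n => hT _ (Or.inl ⟨F n, rfl⟩)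

/-- The extension of `π` to `L^∞(X, ν)` as a unital `*`-homomorphism into `π(C(X))''`. -/
def normalExtension (hν : ∀ v, spectralMeasure π v ≪ ν) :
    Linfty ν →⋆ₐ[ℂ] bicommutant π.range where
  toFun f := ⟨strongExtension hν f, strongExtension_mem_bicommutant hν f⟩
  map_one' := Subtype.ext (strongExtension_one hν)
  map_mul' f g := Subtype.ext (strongExtension_mul hν f g)
  map_zero' := Subtype.ext (by simpa using strongExtension_smul hν 0 0)
  map_add' f g := Subtype.ext (strongExtension_add hν f g)
  commutes' c := Subtype.ext (by
    rw [Algebra.algebraMap_eq_smul_one]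
    exact (strongExtension_smul hν c 1).trans
      ((congrArg _ (strongExtension_one hν)).trans (Algebra.algebraMap_eq_smul_one c).symm))
  map_star' f := Subtype.ext (strongExtension_star hν f)

/-- The functional `f ↦ ∑ ⟨ζₙ, Φ(f) ζₙ⟩` is integration against `∑ₙ μ_{ζₙ}`, a finite measure
dominated by `ν`. -/
lemma exists_hasSum_inner_strongExtension (hν : ∀ v, spectralMeasure π v ≪ ν)
    (ζ : lp (fun _ : ℕ => H) 2) :
    ∃ μ : Measure X, IsFiniteMeasure μ ∧ μ ≪ ν ∧ ∀ f : Linfty ν,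
      HasSum (fun n => inner ℂ (ζ n) (strongExtension hν f (ζ n))) (∫ x, f x ∂μ) := by
  have hsum : Summable fun n => ‖ζ n‖ ^ 2 := by
    simpa using (lp.memℓp ζ).summable (by norm_num)
  have hfin : IsFiniteMeasure (Measure.sum fun n => spectralMeasure π (ζ n)) := by
    refine ⟨?_⟩
    rw [Measure.sum_apply _ MeasurableSet.univ]
    simp only [spectralMeasure_univ]
    rw [← ENNReal.ofReal_tsum_of_nonneg (fun n => by positivity) hsum]
    exact ENNReal.ofReal_lt_top
  have hac : (Measure.sum fun n => spectralMeasure π (ζ n)) ≪ ν :=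
    Measure.absolutelyContinuous_sum_left fun n => hν (ζ n)
  refine ⟨_, hfin, hac, fun f => ?_⟩
  simp only [inner_strongExtension]
  exact hasSum_integral_measure (f.integrable_of_absolutelyContinuous hac)

lemma continuous_normalExtension (hν : ∀ v, spectralMeasure π v ≪ ν) :
    Continuous[Linfty.sigmaWeakTopology ν, (bicommutant π.range).sigmaWeakTopology]
      (normalExtension hν) := by
  refine continuous_iInf_rng.2 fun p => continuous_induced_rng.2 ?_
  obtain ⟨ξ, η⟩ := p
  change Continuous[Linfty.sigmaWeakTopology ν, inferInstance] fun f : Linfty ν =>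
    ∑' n, inner ℂ (η n) (strongExtension hν f (ξ n))
  obtain ⟨μ₁, _, h₁, hs₁⟩ := exists_hasSum_inner_strongExtension hν (η + ξ)
  obtain ⟨μ₂, _, h₂, hs₂⟩ := exists_hasSum_inner_strongExtension hν (η - ξ)
  obtain ⟨μ₃, _, h₃, hs₃⟩ := exists_hasSum_inner_strongExtension hν (η + Complex.I • ξ)
  obtain ⟨μ₄, _, h₄, hs₄⟩ := exists_hasSum_inner_strongExtension hν (η - Complex.I • ξ)
  have heq (f : Linfty ν) : ∑' n, inner ℂ (η n) (strongExtension hν f (ξ n)) =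
      ((∫ x, f x ∂μ₁) - (∫ x, f x ∂μ₂) - Complex.I * (∫ x, f x ∂μ₃) +
        Complex.I * (∫ x, f x ∂μ₄)) / 4 := by
    rw [← (((((hs₁ f).sub (hs₂ f)).sub ((hs₃ f).mul_left Complex.I)).add
      ((hs₄ f).mul_left Complex.I)).div_const 4).tsum_eq]
    exact tsum_congr fun n => ContinuousLinearMap.inner_polarization _ _ _
  let : TopologicalSpace (Linfty ν) := Linfty.sigmaWeakTopology ν
  simp only [heq]
  have c₁ := Linfty.continuous_integral h₁
  have c₂ := Linfty.continuous_integral h₂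
  have c₃ := Linfty.continuous_integral h₃
  have c₄ := Linfty.continuous_integral h₄
  exact ((((c₁.sub c₂).sub (continuous_const.mul c₃)).add (continuous_const.mul c₄)).div_const 4)

end NormalExtension

/-! ### Quasi-invariant averages -/

lemma exists_pos_weights_tsum_eq_one (ι : Type*) [Countable ι] [Nonempty ι] :
    ∃ c : ι → ℝ≥0∞, (∀ i, c i ≠ 0) ∧ ∑' i, c i = 1 := by
  obtain ⟨ε, hε, hsum⟩ := ENNReal.exists_pos_sum_of_countable' one_ne_zero ι
  have h0 : ∑' i, ε i ≠ 0 := fun h =>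
    (hε (Classical.arbitrary ι)).ne' (ENNReal.tsum_eq_zero.1 h _)
  have ht : ∑' i, ε i ≠ ∞ := (hsum.trans ENNReal.one_lt_top).ne
  refine ⟨fun i => ε i / ∑' j, ε j, fun i => (ENNReal.div_pos (hε i).ne' ht).ne', ?_⟩
  simp only [div_eq_mul_inv]
  rw [ENNReal.tsum_mul_right, ENNReal.mul_inv_cancel h0 ht]

/-- Averaging a probability measure over a countable group, with strictly positive weights, gives
a quasi-invariant probability measure: a set is null for the average if and only if all its
translates are null for the given measure. -/
lemma exists_isQuasiInvariant {G X : Type*} [Group G] [Countable G] [TopologicalSpace X]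
    [MeasurableSpace X] [BorelSpace X] [MulAction G X] [ContinuousConstSMul G X]
    (μ : Measure X) [IsProbabilityMeasure μ] [μ.InnerRegular] :
    ∃ ν : Measure X, IsProbabilityMeasure ν ∧ ν.InnerRegular ∧ IsQuasiInvariant G ν ∧
      ∀ s : G, μ.map (fun x => s • x) ≪ ν := by
  obtain ⟨c, hc, hsum⟩ := exists_pos_weights_tsum_eq_one G
  have hreg (s : G) : (μ.map (fun x => s • x)).InnerRegular :=
    Measure.InnerRegular.map (Homeomorph.smul s)
  let ν : Measure X := Measure.sum fun s : G => c s • μ.map (fun x => s • x)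
  have hac (s : G) : μ.map (fun x => s • x) ≪ ν :=
    (Measure.absolutelyContinuous_smul (hc s)).trans
      (Measure.absolutelyContinuous_of_le (Measure.le_sum (fun s : G =>
        c s • μ.map (fun x => s • x)) s))
  have hmap (t : G) : ν.map (fun x => t • x) ≪ ν := by
    have : ν.map (fun x => t • x) =
        Measure.sum fun s : G => c s • μ.map (fun x => (t * s) • x) := by
      rw [Measure.map_sum (measurable_const_smul t).aemeasurable]
      congr 1 with s : 1
      rw [Measure.map_smul, Measure.map_map (measurable_const_smul t) (measurable_const_smul s)]
      simp only [Function.comp_def, mul_smul]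
    rw [this]
    exact Measure.absolutelyContinuous_sum_left fun s =>
      Measure.smul_absolutelyContinuous.trans (hac (t * s))
  refine ⟨ν, ⟨?_⟩, inferInstance, fun t => ⟨hmap t, ?_⟩, hac⟩
  · have hprob (s : G) : μ.map (fun x => s • x) Set.univ = 1 := by
      rw [Measure.map_apply (measurable_const_smul s) MeasurableSet.univ, Set.preimage_univ,
        measure_univ]
    simp [ν, hprob, hsum]
  · have h := (hmap t⁻¹).map (measurable_const_smul t)
    rw [Measure.map_map (measurable_const_smul t) (measurable_const_smul t⁻¹)] at h
    simpa [Function.comp_def] using h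

/-! ### Covariant representations -/

namespace CovariantRep

variable {G X H : Type*} [Group G] [TopologicalSpace X] [CompactSpace X]
  [MulAction G X] [ContinuousConstSMul G X]
  [NormedAddCommGroup H] [InnerProductSpace ℂ H] [CompleteSpace H] (R : CovariantRep G X H)

lemma dense_range_integratedForm_apply {ξ : H}
    (hξ : Dense ((fun T : H →L[ℂ] H => T ξ) '' R.crossedProductImage)) :
    Dense (Set.range fun a => R.integratedForm a ξ) := by
  rw [← dense_closure]
  refine hξ.mono ((image_closure_subset_closure_image (by fun_prop)).trans ?_)
  rw [← Set.range_comp]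
  rfl

lemma u_star_apply (s : G) (v : H) :
    (R.u s : H →L[ℂ] H) (star (R.u s : H →L[ℂ] H) v) = v := by
  have h : (R.u s : H →L[ℂ] H) * star (R.u s : H →L[ℂ] H) = 1 := Unitary.coe_mul_star_self _
  exact DFunLike.congr_fun h v

variable [T2Space X] [MeasurableSpace X] [BorelSpace X]

/-- For a cyclic vector `ξ`, a measure that dominates the spectral measures of all `u_s ξ`
dominates every spectral measure: the vectors `π(g) u_s ξ` span a dense subspace, and on
them `π(F n)` tends to `0` when `F n → 0` boundedly almost everywhere. -/
lemma spectralMeasure_absolutelyContinuous_of_cyclic {ξ : H}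
    (hξ : Dense ((fun T : H →L[ℂ] H => T ξ) '' R.crossedProductImage)) {ν : Measure X}
    [IsFiniteMeasure ν] [ν.InnerRegular]
    (hν : ∀ s, spectralMeasure R.π ((R.u s : H →L[ℂ] H) ξ) ≪ ν) (v : H) :
    spectralMeasure R.π v ≪ ν := by
  refine spectralMeasure_absolutelyContinuous _ fun F hF => ?_
  obtain ⟨M, hM⟩ := hF.bound
  refine tendsto_apply_zero_of_dense _ hM (R.dense_range_integratedForm_apply hξ) ?_ v
  rintro _ ⟨a, rfl⟩
  have heq (n : ℕ) : R.π (F n) (R.integratedForm a ξ) =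
      ∑ s ∈ a.support, R.π (a s) (R.π (F n) ((R.u s : H →L[ℂ] H) ξ)) := by
    simp only [integratedForm, Finsupp.sum, sum_apply, map_sum]
    refine Finset.sum_congr rfl fun s _ => ?_
    simp only [← mul_apply_eq_comp, ← mul_assoc, ← map_mul, mul_comm]
  simp only [heq]
  rw [← Finset.sum_const_zero (s := a.support)]
  refine tendsto_finsetSum _ fun s _ => ?_
  rw [← map_zero (R.π (a s))]
  exact ((R.π (a s)).continuous.tendsto 0).comp (hF.mono (hν s)).tendsto_apply_zero

/-- The extension of `π` to `L^∞(X, ν)` is equivariant, because spectral measures are. -/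
lemma strongExtension_translate {ν : Measure X} [IsFiniteMeasure ν] [ν.InnerRegular]
    (hac : ∀ v, spectralMeasure R.π v ≪ ν) (hν : IsQuasiInvariant G ν) (s : G) (f : Linfty ν) :
    strongExtension hac (Linfty.translate hν s f) =
      (R.u s : H →L[ℂ] H) * strongExtension hac f * star (R.u s : H →L[ℂ] H) := by
  refine ContinuousLinearMap.ext_inner_self fun v => ?_
  set w := star (R.u s : H →L[ℂ] H) v with hw
  have hμ : spectralMeasure R.π v = (spectralMeasure R.π w).map (fun x => s • x) := by
    rw [← R.spectralMeasure_u, hw, R.u_star_apply]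
  have h1 : inner ℂ v (((R.u s : H →L[ℂ] H) * strongExtension hac f *
      star (R.u s : H →L[ℂ] H)) v) = inner ℂ w (strongExtension hac f w) := by
    rw [mul_apply_eq_comp, mul_apply_eq_comp, ← ContinuousLinearMap.adjoint_inner_left,
      ← ContinuousLinearMap.star_eq_adjoint]
  have hqmp : Measure.QuasiMeasurePreserving (fun x : X => s⁻¹ • x) ν ν :=
    ⟨measurable_const_smul s⁻¹, (hν s⁻¹).1⟩
  have hcoe : Linfty.translate hν s f =ᵐ[ν] fun x => f (s⁻¹ • x) :=
    AEEqFun.coeFn_compQuasiMeasurePreserving f.1 hqmp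
  rw [h1, inner_strongExtension, inner_strongExtension, integral_congr_ae ((hac v).ae_le hcoe), hμ,
    (measurableEmbedding_const_smul s).integral_map]
  simp

end CovariantRep

end

theorem mainTheorem7 {G X H : Type*} [Group G] [Countable G]
    [TopologicalSpace X] [CompactSpace X] [T2Space X] [Nonempty X]
    [MeasurableSpace X] [BorelSpace X]
    [MulAction G X] [ContinuousConstSMul G X]
    [NormedAddCommGroup H] [InnerProductSpace ℂ H] [CompleteSpace H]
    (R : CovariantRep G X H) (hR : R.IsCyclic) :
    ∃ ν : Measure X, IsProbabilityMeasure ν ∧ ν.Regular ∧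
      ∃ hν : IsQuasiInvariant G ν,
        ∃ Φ : Linfty ν →⋆ₐ[ℂ] R.vonNeumann,
          Continuous[Linfty.sigmaWeakTopology ν, R.vonNeumann.sigmaWeakTopology] Φ ∧
          ∀ (s : G) (f : Linfty ν),
            ((Φ (Linfty.translate hν s f) : R.vonNeumann) : H →L[ℂ] H) =
              (R.u s : H →L[ℂ] H) * (Φ f : H →L[ℂ] H) * star (R.u s : H →L[ℂ] H) := by
  obtain ⟨ξ, hξ⟩ := hR
  -- The spectral measure of `ξ` vanishes only if `H = 0`; a point mass serves as `μ` in that case,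
  -- and the normalized spectral measure otherwise.
  obtain ⟨μ, _, _, hμ⟩ : ∃ μ : Measure X, IsProbabilityMeasure μ ∧ μ.InnerRegular ∧
      spectralMeasure R.π ξ ≪ μ := by
    by_cases h0 : spectralMeasure R.π ξ = 0
    · obtain ⟨x⟩ := ‹Nonempty X›
      refine ⟨Measure.dirac x, inferInstance, ⟨fun U hU r hr => ?_⟩, ?_⟩
      · have hx : x ∈ U := by
          by_contra hx
          simp [Measure.dirac_apply' _ hU, hx] at hr
        refine ⟨{x}, by simpa using hx, isCompact_singleton, ?_⟩
        rw [Measure.dirac_apply_of_mem (Set.mem_singleton x)]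
        rwa [Measure.dirac_apply_of_mem hx] at hr
      · rw [h0]
        exact Measure.AbsolutelyContinuous.zero _
    · have : NeZero (spectralMeasure R.π ξ) := ⟨h0⟩
      exact ⟨_, isProbabilityMeasureSMul, inferInstance, Measure.absolutelyContinuous_smul
        (ENNReal.inv_ne_zero.2 (measure_ne_top _ _))⟩
  obtain ⟨ν, _, _, hν, hμν⟩ := exists_isQuasiInvariant (G := G) μ
  have hac : ∀ v, spectralMeasure R.π v ≪ ν :=
    R.spectralMeasure_absolutelyContinuous_of_cyclic hξ fun s => by
      rw [R.spectralMeasure_u]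
      exact (hμ.map (measurable_const_smul s)).trans (hμν s)
  exact ⟨ν, inferInstance, inferInstance, hν, normalExtension hac,
    continuous_normalExtension hac, R.strongExtension_translate hac hν⟩
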